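/- Let $\mathbb D=\{z\in\mathbb C:|z|<1\}$ and $0\le\alpha<1$. Let $\mathcal P^0_{\mathcal H}(\alpha)$ be the class of harmonic functions $f=h+\overline g$ in $\mathbb D$, where $h(z)=z+\sum_{n\ge2}a_nz^n$ and $g(z)=\sum_{n\ge2}b_nz^n$ are analytic in $\mathbb D$, such that $\operatorname{Re}(h'(z)-\alpha)>|g'(z)|$ for all $z\in\mathbb D$. For $f\in\mathcal P^0_{\mathcal H}(\alpha)$ let $S_r$ be the area of the image of the disk $|z|<r$ under $f$, and let $d(f(0),\partial f(\mathbb D))$ be the Euclidean distance from $f(0)$ to the boundary of $f(\mathbb D)$. The equation $$r^2+r-1-2(1-\alpha)\bigl(r+\ln(1-r)\bigr)-4(1-\alpha)^2\bigl(r^2+\ln(1-r^2)\bigr)-2(1-\alpha)(\ln2-1)=0$$ has a smallest root $r_\alpha$ in $(0,1)$. For every $f\in\mathcal P^0_{\mathcal H}(\alpha)$ and every $0\le r\le r_\alpha$ the series below converges and $$r+\sum_{n=2}^\infty(|a_n|+|b_n|)r^n+\frac{S_r}{\pi}\le d\bigl(f(0),\partial f(\mathbb D)\bigr).$$ The radius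 $r_\alpha$ is best possible: for every $r\in(r_\alpha,1)$ there is an $f\in\mathcal P^0_{\mathcal H}(\alpha)$ for which the inequality fails. -/

import Mathlib

open Set Metric MeasureTheory

noncomputable section

/-- The open unit disk. -/
def unitDisk : Set ℂ := ball (0 : ℂ) 1

/-- The harmonic map `f = h + conj g` with analytic part `h` and co-analytic part `g`. -/
def harmonicMap (h g : ℂ → ℂ) : ℂ → ℂ := fun z => h z + (starRingEnd ℂ) (g z)

/-- The harmonic function `f = h + conj g` belongs to the class `P_H^0(α)`:
`h` and `g` are analytic in the unit disk, `h(0) = h'(0) - 1 = 0`, `g(0) = g'(0) = 0`, and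
`Re (h'(z) - α) > |g'(z)|` in the unit disk. -/
structure IsClassPH0 (α : ℝ) (h g : ℂ → ℂ) : Prop where
  analytic_h : DifferentiableOn ℂ h unitDisk
  analytic_g : DifferentiableOn ℂ g unitDisk
  h_zero : h 0 = 0
  deriv_h_zero : deriv h 0 = 1
  g_zero : g 0 = 0
  deriv_g_zero : deriv g 0 = 0
  re_gt : ∀ z ∈ unitDisk, ‖deriv g z‖ < (deriv h z - (α : ℂ)).re

/-- The `n`-th Taylor coefficient of `h` at the origin. -/
def taylorCoeff (h : ℂ → ℂ) (n : ℕ) : ℂ := iteratedDeriv n h 0 / (n.factorial : ℂ)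

/-- The term `(|a_n| + |b_n|) r^n`, where `a_n`, `b_n` are the Taylor coefficients of `h`, `g`. -/
def majorantTerm (h g : ℂ → ℂ) (r : ℝ) (n : ℕ) : ℝ :=
  (‖taylorCoeff h n‖ + ‖taylorCoeff g n‖) * r ^ n

/-- `S_r`: the area of the image of the disk `|z| < r` under `f`. -/
def imageArea (f : ℂ → ℂ) (r : ℝ) : ℝ := (volume (f '' ball (0 : ℂ) r)).toReal

/-- `r + ∑_{n ≥ 2} (|a_n| + |b_n|) r^n + S_r / π`. -/
def bohrAreaSum (h g : ℂ → ℂ) (r : ℝ) : ℝ :=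
  r + ∑' n : ℕ, majorantTerm h g r (n + 2) + imageArea (harmonicMap h g) r / Real.pi

/-- `d(f(0), ∂f(𝔻))`: the Euclidean distance from `f(0)` to the boundary of the image of the
unit disk. -/
def boundaryDist (f : ℂ → ℂ) : ℝ := infDist (f 0) (frontier (f '' unitDisk))

/-- The left-hand side of the equation that determines the radius. -/
def radiusFun (α r : ℝ) : ℝ :=
  r ^ 2 + r - 1 - 2 * (1 - α) * (r + Real.log (1 - r))
    - 4 * (1 - α) ^ 2 * (r ^ 2 + Real.log (1 - r ^ 2)) - 2 * (1 - α) * (Real.log 2 - 1)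

end

/-!
Write `f = h + conj g`. For every unimodular `l` the analytic function `h' + l g'` takes the value
`1` at the origin and has real part greater than `α`. Carathéodory's coefficient bound for such
functions (`norm_taylorCoeff_le`) gives `|a_n| + |b_n| ≤ 2 (1 - α) / n`, and Harnack's inequality
(`harnack_le_re`) gives `Re h' - |g'| ≥ α + (1 - α) (1 - |z|) / (1 + |z|)`.

The coefficient bound estimates the majorant series by a logarithm. The area of the image of a
disk is at most the integral of the Jacobian, hence of `|h'|²`, which Parseval's identity turns
into a series in `|a_n|²`; this is bounded by a logarithm as well. Altogether the Bohr sum is at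
most `radiusFun α r + growthBound α 1` (`IsClassPH0.bohrAreaSum_le`).

On the other side, the component of `f` in the direction `e` increases along rays in the direction
`e` at the rate at least `Re h' - |g'|`. Hence `f` is injective, `|f z| ≥ growthBound α |z|`, and
finite limits of `f` along sequences that tend to the unit circle are boundary points of the image
(`IsClassPH0.mem_frontier_of_tendsto`). Since `f` is open, every boundary point arises in this
way, so the boundary is at distance at least `growthBound α 1 = 1 + 2 (1 - α) (log 2 - 1)` from
the origin. As the distance to an empty set would be zero by convention, one also needs that the
image is not the whole plane: by the coefficient bounds the quadratic means of `f` over circles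
are bounded, so `f` cannot tend to infinity at the unit circle (`IsClassPH0.nonempty_frontier`).

The function `radiusFun α` is strictly increasing on `[0, 1)` and has exactly one zero there,
which is the radius sought. It is best possible because of the analytic map `z + ∑ 2 (1 - α) zⁿ /
n` (sum over `n ≥ 2`): its Bohr sum is equal to `radiusFun α r + growthBound α 1`
(`bohrAreaSum_extremalMap`), and its values along the negative radius tend to the boundary point
`-growthBound α 1` (`boundaryDist_extremalMap_le`).
-/

/-! ### Absolutely convergent exponential series -/

theorem norm_exp_intCast_mul_I (k : ℤ) (t : ℝ) : ‖Complex.exp (k * t * Complex.I)‖ = 1 := by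
  have := Complex.norm_exp_ofReal_mul_I (k * t)
  push_cast at this
  exact this

theorem norm_exp_natCast_mul_I (n : ℕ) (t : ℝ) : ‖Complex.exp (n * t * Complex.I)‖ = 1 := by
  exact_mod_cast norm_exp_intCast_mul_I n t

theorem integral_exp_int_mul_I (k : ℤ) :
    ∫ t in -Real.pi..Real.pi, Complex.exp (k * t * Complex.I) =
      if k = 0 then 2 * (Real.pi : ℂ) else 0 := by
  split_ifs with hk
  · subst hk
    simp
    ring
  · have hk' : (k : ℂ) * Complex.I ≠ 0 := by simp [hk]
    have h1 : ∀ t : ℝ, Complex.exp (k * t * Complex.I) = Complex.exp (k * Complex.I * t) := by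
      intro t; congr 1; ring
    simp_rw [h1]
    rw [integral_exp_mul_complex hk']
    have h2 : Complex.exp (k * Complex.I * (Real.pi : ℝ))
        = Complex.exp (k * Complex.I * (-Real.pi : ℝ)) := by
      rw [Complex.exp_eq_exp_iff_exists_int]
      exact ⟨k, by push_cast; ring⟩
    rw [h2]; simp

/-- An absolutely convergent exponential series may be integrated term by term against a bounded
continuous function. -/
theorem hasSum_integral_exp_series_mul {d : ℕ → ℂ} (hd : Summable fun n => ‖d n‖) {G φ : ℝ → ℂ}
    (hG : ∀ t : ℝ, HasSum (fun n : ℕ => d n * Complex.exp (n * t * Complex.I)) (G t))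
    (hφ : Continuous φ) {C : ℝ} (hC : ∀ t, ‖φ t‖ ≤ C) :
    HasSum (fun n => d n * ∫ t in -Real.pi..Real.pi, Complex.exp (n * t * Complex.I) * φ t)
      (∫ t in -Real.pi..Real.pi, G t * φ t) := by
  have key := intervalIntegral.hasSum_integral_of_dominated_convergence (μ := volume)
    (a := -Real.pi) (b := Real.pi)
    (F := fun (n : ℕ) (t : ℝ) => d n * Complex.exp (n * t * Complex.I) * φ t)
    (f := fun t => G t * φ t) (fun n _ => ‖d n‖ * C) ?_ ?_ ?_ ?_ ?_
  · refine key.congr_fun fun n => ?_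
    simp only [mul_assoc]
    rw [← intervalIntegral.integral_const_mul]
  · intro n
    exact Continuous.aestronglyMeasurable (by fun_prop)
  · intro n
    refine Filter.Eventually.of_forall fun t _ => ?_
    rw [norm_mul, norm_mul, norm_exp_natCast_mul_I, mul_one]
    gcongr
    exact hC t
  · exact Filter.Eventually.of_forall fun t _ => hd.mul_right C
  · simp
  · exact Filter.Eventually.of_forall fun t _ => (hG t).mul_right _

/-- Integration against `exp (i k t)` picks out the coefficient with index `-k`. -/
theorem integral_exp_series_mul_exp {d : ℕ → ℂ} (hd : Summable fun n => ‖d n‖) {G : ℝ → ℂ}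
    (hG : ∀ t : ℝ, HasSum (fun n : ℕ => d n * Complex.exp (n * t * Complex.I)) (G t)) (k : ℤ) :
    HasSum (fun n : ℕ => if (n : ℤ) + k = 0 then 2 * Real.pi * d n else 0)
      (∫ t in -Real.pi..Real.pi, G t * Complex.exp (k * t * Complex.I)) := by
  have hC : ∀ t : ℝ, ‖Complex.exp (k * t * Complex.I)‖ ≤ 1 := fun t =>
    (norm_exp_intCast_mul_I k t).le
  have key := hasSum_integral_exp_series_mul hd hG
    (φ := fun t : ℝ => Complex.exp (k * t * Complex.I)) (by fun_prop) hC
  convert key using 2 with n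
  have := integral_exp_int_mul_I (n + k)
  have h1 : ∀ t : ℝ, Complex.exp (n * t * Complex.I) * Complex.exp (k * t * Complex.I)
      = Complex.exp (((n + k : ℤ) : ℂ) * t * Complex.I) := by
    intro t; rw [← Complex.exp_add]; push_cast; congr 1; ring
  simp_rw [h1, this]
  split_ifs <;> ring

theorem integral_exp_series_mul_exp_neg {d : ℕ → ℂ} (hd : Summable fun n => ‖d n‖) {G : ℝ → ℂ}
    (hG : ∀ t : ℝ, HasSum (fun n : ℕ => d n * Complex.exp (n * t * Complex.I)) (G t)) (m : ℕ) :
    ∫ t in -Real.pi..Real.pi, G t * Complex.exp (-(m * t * Complex.I)) = 2 * Real.pi * d m := by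
  have h1 := integral_exp_series_mul_exp hd hG (-(m : ℤ))
  have h2 : HasSum (fun n : ℕ => if (n : ℤ) + -(m : ℤ) = 0 then 2 * Real.pi * d n else 0)
      (2 * Real.pi * d m) := by
    convert hasSum_ite_eq m (2 * Real.pi * d m) using 2 with n
    by_cases h : n = m
    · simp [h]
    · have : ¬ ((n : ℤ) + -(m : ℤ) = 0) := by omega
      rw [if_neg this, if_neg h]
  have := h1.unique h2
  rw [← this]
  push_cast
  simp only [neg_mul]

theorem integral_exp_series_mul_exp_pos {d : ℕ → ℂ} (hd : Summable fun n => ‖d n‖) {G : ℝ → ℂ}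
    (hG : ∀ t : ℝ, HasSum (fun n : ℕ => d n * Complex.exp (n * t * Complex.I)) (G t))
    {m : ℕ} (hm : m ≠ 0) :
    ∫ t in -Real.pi..Real.pi, G t * Complex.exp (m * t * Complex.I) = 0 := by
  have h1 := integral_exp_series_mul_exp hd hG (m : ℤ)
  have h2 : (fun n : ℕ => if (n : ℤ) + (m : ℤ) = 0 then 2 * Real.pi * d n else 0) = fun _ => 0 := by
    funext n
    rw [if_neg (by omega)]
  rw [h2] at h1
  simpa using h1.unique hasSum_zero

theorem continuous_exp_series {d : ℕ → ℂ} (hd : Summable fun n => ‖d n‖) {G : ℝ → ℂ}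
    (hG : ∀ t : ℝ, HasSum (fun n : ℕ => d n * Complex.exp (n * t * Complex.I)) (G t)) :
    Continuous G := by
  have : G = fun t : ℝ => ∑' n : ℕ, d n * Complex.exp (n * t * Complex.I) :=
    funext fun t => (hG t).tsum_eq.symm
  rw [this]
  refine continuous_tsum (fun n => by fun_prop) hd fun n t => ?_
  rw [norm_mul, norm_exp_natCast_mul_I, mul_one]

/-- Parseval's identity for absolutely convergent exponential series. -/
theorem hasSum_sq_exp_series {d : ℕ → ℂ} (hd : Summable fun n => ‖d n‖) {G : ℝ → ℂ}
    (hG : ∀ t : ℝ, HasSum (fun n : ℕ => d n * Complex.exp (n * t * Complex.I)) (G t)) :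
    HasSum (fun n => 2 * Real.pi * ‖d n‖ ^ 2) (∫ t in -Real.pi..Real.pi, ‖G t‖ ^ 2) := by
  have hcont := continuous_exp_series hd hG
  have hC : ∀ t, ‖(starRingEnd ℂ) (G t)‖ ≤ ∑' n, ‖d n‖ := by
    intro t
    rw [RCLike.norm_conj, ← (hG t).tsum_eq]
    have h1 : ∀ n : ℕ, ‖d n * Complex.exp (n * t * Complex.I)‖ = ‖d n‖ := by
      intro n
      rw [norm_mul, norm_exp_natCast_mul_I, mul_one]
    refine (norm_tsum_le_tsum_norm ?_).trans_eq ?_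
    · simpa only [h1] using hd
    · simp only [h1]
  have key := hasSum_integral_exp_series_mul hd hG
    (φ := fun t => (starRingEnd ℂ) (G t)) (Complex.continuous_conj.comp hcont) hC
  have hcoef : ∀ n : ℕ, d n * ∫ t in -Real.pi..Real.pi,
      Complex.exp (n * t * Complex.I) * (starRingEnd ℂ) (G t)
      = ((2 * Real.pi * ‖d n‖ ^ 2 : ℝ) : ℂ) := by
    intro n
    have h1 : ∀ t : ℝ, Complex.exp (n * t * Complex.I) * (starRingEnd ℂ) (G t)
        = (starRingEnd ℂ) (G t * Complex.exp (-(n * t * Complex.I))) := by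
      intro t
      rw [map_mul, ← Complex.exp_conj]
      simp [mul_comm]
    simp_rw [h1]
    rw [intervalIntegral.integral_of_le (by linarith [Real.pi_pos]), integral_conj,
      ← intervalIntegral.integral_of_le (by linarith [Real.pi_pos]),
      integral_exp_series_mul_exp_neg hd hG n]
    have h2 : d n * (starRingEnd ℂ) (d n) = ((‖d n‖ ^ 2 : ℝ) : ℂ) := by
      rw [Complex.mul_conj, Complex.normSq_eq_norm_sq]
    push_cast at h2 ⊢
    rw [← h2]
    simp only [map_mul, Complex.conj_ofReal, map_ofNat]
    ring
  have hint : ∫ t in -Real.pi..Real.pi, G t * (starRingEnd ℂ) (G t)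
      = ((∫ t in -Real.pi..Real.pi, ‖G t‖ ^ 2 : ℝ) : ℂ) := by
    rw [← intervalIntegral.integral_ofReal]
    congr 1
    funext t
    rw [Complex.mul_conj, Complex.normSq_eq_norm_sq]
  simp_rw [hcoef] at key
  rw [hint] at key
  exact Complex.hasSum_ofReal.mp key

/-! ### Taylor coefficients on the unit disk -/

theorem hasSum_taylorCoeff {f : ℂ → ℂ} (hf : DifferentiableOn ℂ f unitDisk) {z : ℂ}
    (hz : z ∈ unitDisk) : HasSum (fun n => taylorCoeff f n * z ^ n) (f z) := by
  have := Complex.hasSum_taylorSeries_on_ball (f := f) (c := 0) (r := 1)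
    (by simpa [unitDisk] using hf) (by simpa [unitDisk] using hz)
  refine this.congr_fun fun n => ?_
  simp only [taylorCoeff, div_eq_mul_inv, sub_zero, smul_eq_mul]
  ring

theorem norm_lt_one_of_mem {z : ℂ} (hz : z ∈ unitDisk) : ‖z‖ < 1 := by
  simpa [unitDisk] using hz

theorem mem_unitDisk {z : ℂ} (hz : ‖z‖ < 1) : z ∈ unitDisk := by
  simpa [unitDisk] using hz

theorem isOpen_unitDisk : IsOpen unitDisk := isOpen_ball

theorem summable_norm_taylorCoeff {f : ℂ → ℂ} (hf : DifferentiableOn ℂ f unitDisk) {ρ : ℝ}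
    (h0 : 0 ≤ ρ) (h1 : ρ < 1) : Summable fun n => ‖taylorCoeff f n * (ρ : ℂ) ^ n‖ := by
  have : (ρ : ℂ) ∈ unitDisk := mem_unitDisk (by simpa [abs_of_nonneg h0] using h1)
  exact (hasSum_taylorCoeff hf this).summable.norm

theorem circle_mem_unitDisk {ρ : ℝ} (h0 : 0 ≤ ρ) (h1 : ρ < 1) (t : ℝ) :
    (ρ : ℂ) * Complex.exp (t * Complex.I) ∈ unitDisk :=
  mem_unitDisk (by simpa [abs_of_nonneg h0] using h1)

theorem hasSum_taylorCoeff_circle {f : ℂ → ℂ} (hf : DifferentiableOn ℂ f unitDisk) {ρ : ℝ}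
    (h0 : 0 ≤ ρ) (h1 : ρ < 1) (t : ℝ) :
    HasSum (fun n : ℕ => taylorCoeff f n * (ρ : ℂ) ^ n * Complex.exp (n * t * Complex.I))
      (f (ρ * Complex.exp (t * Complex.I))) := by
  convert hasSum_taylorCoeff hf (circle_mem_unitDisk h0 h1 t) using 2 with n
  rw [mul_pow, ← Complex.exp_nat_mul, mul_assoc, mul_assoc]

/-- Parseval's identity on the circle of radius `ρ`. -/
theorem hasSum_sq_taylorCoeff {f : ℂ → ℂ} (hf : DifferentiableOn ℂ f unitDisk) {ρ : ℝ}
    (h0 : 0 ≤ ρ) (h1 : ρ < 1) :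
    HasSum (fun n => 2 * Real.pi * (‖taylorCoeff f n‖ ^ 2 * ρ ^ (2 * n)))
      (∫ t in -Real.pi..Real.pi, ‖f (ρ * Complex.exp (t * Complex.I))‖ ^ 2) := by
  convert hasSum_sq_exp_series (summable_norm_taylorCoeff hf h0 h1)
    (hasSum_taylorCoeff_circle hf h0 h1) using 2 with n
  rw [norm_mul, mul_pow, norm_pow, Complex.norm_real, Real.norm_of_nonneg h0, ← pow_mul,
    mul_comm n 2]

theorem continuous_comp_circle {f : ℂ → ℂ} (hf : DifferentiableOn ℂ f unitDisk) {ρ : ℝ}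
    (h0 : 0 ≤ ρ) (h1 : ρ < 1) :
    Continuous fun t : ℝ => f (ρ * Complex.exp (t * Complex.I)) :=
  continuous_exp_series (summable_norm_taylorCoeff hf h0 h1) (hasSum_taylorCoeff_circle hf h0 h1)

theorem taylorCoeff_zero (f : ℂ → ℂ) : taylorCoeff f 0 = f 0 := by simp [taylorCoeff]

theorem taylorCoeff_one (f : ℂ → ℂ) : taylorCoeff f 1 = deriv f 0 := by simp [taylorCoeff]

theorem taylorCoeff_deriv (f : ℂ → ℂ) (n : ℕ) :
    taylorCoeff (deriv f) n = (n + 1) * taylorCoeff f (n + 1) := by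
  have h1 : (n.factorial : ℂ) ≠ 0 := by exact_mod_cast n.factorial_ne_zero
  have h2 : (n + 1 : ℂ) ≠ 0 := by exact_mod_cast n.succ_ne_zero
  rw [taylorCoeff, taylorCoeff, iteratedDeriv_succ', Nat.factorial_succ]
  push_cast
  field_simp

/-- A power series that represents `f` on the disk is the Taylor series of `f`. -/
theorem taylorCoeff_eq_of_hasSum {f : ℂ → ℂ} {c : ℕ → ℂ}
    (h : ∀ z ∈ unitDisk, HasSum (fun n => c n * z ^ n) (f z)) (n : ℕ) : taylorCoeff f n = c n := by
  have hs : HasFPowerSeriesOnBall f (FormalMultilinearSeries.ofScalars ℂ c) 0 1 := by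
    refine ⟨?_, by simp, ?_⟩
    · refine ENNReal.le_of_forall_nnreal_lt fun ρ hρ => ?_
      refine FormalMultilinearSeries.le_radius_of_summable_norm _ ?_
      have hρ' : ((ρ : ℝ) : ℂ) ∈ unitDisk := mem_unitDisk (by simpa using hρ)
      have := (h _ hρ').summable.norm
      refine this.congr fun n => ?_
      simp
    · intro y hy
      have hy' : y ∈ unitDisk := by
        refine mem_unitDisk ?_
        simpa [enorm, ← NNReal.coe_lt_coe] using hy
      simpa [FormalMultilinearSeries.ofScalars_apply_eq, mul_comm] using h y hy'
  have := hs.factorial_smul 1 n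
  rw [taylorCoeff, iteratedDeriv_eq_iteratedFDeriv]
  have h1 : (n.factorial : ℂ) ≠ 0 := by exact_mod_cast n.factorial_ne_zero
  rw [div_eq_iff h1, ← this]
  simp [mul_comm]

/-! ### Functions with real part bounded below -/

/-- **Carathéodory's coefficient bound**: a function with `F 0 = 1` and real part greater than `α`
has Taylor coefficients at most `2 (1 - α)`. On the circle of radius `ρ` the `n`-th coefficient is
the `n`-th Fourier coefficient of `2 (Re F - α)`, since `conj F` contributes nothing; hence it is at
most the mean value of `2 (Re F - α)`. -/
theorem norm_taylorCoeff_le {F : ℂ → ℂ} {α : ℝ} (hF : DifferentiableOn ℂ F unitDisk) (hF0 : F 0 = 1)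
    (hre : ∀ z ∈ unitDisk, α < (F z).re) {n : ℕ} (hn : n ≠ 0) :
    ‖taylorCoeff F n‖ ≤ 2 * (1 - α) := by
  have hpi := Real.pi_pos
  have main : ∀ ρ : ℝ, 0 ≤ ρ → ρ < 1 → ‖taylorCoeff F n‖ * ρ ^ n ≤ 2 * (1 - α) := by
    intro ρ h0 h1
    set G : ℝ → ℂ := fun t => F (ρ * Complex.exp (t * Complex.I)) with hGdef
    have hsum := summable_norm_taylorCoeff hF h0 h1
    have hG := hasSum_taylorCoeff_circle hF h0 h1
    have hcont : Continuous G := continuous_comp_circle hF h0 h1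
    have e0 : ∫ t in -Real.pi..Real.pi, G t = 2 * Real.pi := by
      have := integral_exp_series_mul_exp_neg hsum hG 0
      simpa [taylorCoeff_zero, hF0] using this
    have en := integral_exp_series_mul_exp_neg hsum hG n
    have ep := integral_exp_series_mul_exp_pos hsum hG hn
    have ec : ∫ t in -Real.pi..Real.pi,
        (starRingEnd ℂ) (G t) * Complex.exp (-(n * t * Complex.I)) = 0 := by
      have h1 : ∀ t : ℝ, (starRingEnd ℂ) (G t) * Complex.exp (-(n * t * Complex.I))
          = (starRingEnd ℂ) (G t * Complex.exp (n * t * Complex.I)) := by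
        intro t
        rw [map_mul, ← Complex.exp_conj]
        simp
      simp_rw [h1]
      rw [intervalIntegral.integral_of_le (by linarith), integral_conj,
        ← intervalIntegral.integral_of_le (by linarith), ep, map_zero]
    have eα : ∫ t in -Real.pi..Real.pi, Complex.exp (-(n * t * Complex.I)) = 0 := by
      have := integral_exp_int_mul_I (-(n : ℤ))
      rw [if_neg (by omega)] at this
      simpa using this
    -- as `2 Re F = F + conj F`, only the contribution of `F` survives the integration
    have etot : ∫ t in -Real.pi..Real.pi,
        ((2 * ((G t).re - α) : ℝ) : ℂ) * Complex.exp (-(n * t * Complex.I))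
        = 2 * Real.pi * (taylorCoeff F n * (ρ : ℂ) ^ n) := by
      rw [← en]
      have h2 : ∀ t : ℝ, ((2 * ((G t).re - α) : ℝ) : ℂ) * Complex.exp (-(n * t * Complex.I))
          = G t * Complex.exp (-(n * t * Complex.I))
            + (starRingEnd ℂ) (G t) * Complex.exp (-(n * t * Complex.I))
            - 2 * α * Complex.exp (-(n * t * Complex.I)) := by
        intro t
        have : G t + (starRingEnd ℂ) (G t) = ((2 * (G t).re : ℝ) : ℂ) := Complex.add_conj _
        rw [← add_mul, this]
        push_cast; ring
      have hc' : Continuous fun t => (starRingEnd ℂ) (G t) := Complex.continuous_conj.comp hcont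
      simp_rw [h2]
      rw [intervalIntegral.integral_sub, intervalIntegral.integral_add,
        intervalIntegral.integral_const_mul, ec, eα]
      · simp [hGdef]
      all_goals exact Continuous.intervalIntegrable (by fun_prop) _ _
    have ere : ∫ t in -Real.pi..Real.pi, 2 * ((G t).re - α) = 2 * Real.pi * (2 * (1 - α)) := by
      have h3 : ∫ t in -Real.pi..Real.pi, (G t).re = 2 * Real.pi := by
        have h4 := Complex.reCLM.intervalIntegral_comp_comm
          (hcont.intervalIntegrable (μ := volume) (-Real.pi) Real.pi)
        rw [e0] at h4
        simpa using h4
      rw [intervalIntegral.integral_const_mul, intervalIntegral.integral_sub, h3]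
      · simp; ring
      all_goals exact Continuous.intervalIntegrable (by fun_prop) _ _
    have hle : ‖∫ t in -Real.pi..Real.pi,
        ((2 * ((G t).re - α) : ℝ) : ℂ) * Complex.exp (-(n * t * Complex.I))‖
        ≤ ∫ t in -Real.pi..Real.pi, 2 * ((G t).re - α) := by
      refine intervalIntegral.norm_integral_le_of_norm_le (by linarith) ?_
        (Continuous.intervalIntegrable (by fun_prop) _ _)
      refine Filter.Eventually.of_forall fun t _ => ?_
      have h5 : ‖Complex.exp (-(n * t * Complex.I))‖ = 1 := by
        simpa using norm_exp_intCast_mul_I (-(n : ℤ)) t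
      have h6 := hre _ (circle_mem_unitDisk h0 h1 t)
      rw [norm_mul, h5, mul_one, Complex.norm_real, Real.norm_of_nonneg]
      have : α < (G t).re := h6
      linarith
    rw [etot, ere, norm_mul, norm_mul, norm_mul, norm_pow, Complex.norm_real, Complex.norm_real,
      Real.norm_of_nonneg h0, Real.norm_of_nonneg hpi.le, Complex.norm_ofNat] at hle
    exact le_of_mul_le_mul_left hle (by positivity)
  have hlim : Filter.Tendsto (fun ρ : ℝ => ‖taylorCoeff F n‖ * ρ ^ n) (nhdsWithin 1 (Iio 1))
      (nhds (‖taylorCoeff F n‖ * 1 ^ n)) :=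
    ((continuous_const.mul (continuous_pow n)).tendsto _).mono_left nhdsWithin_le_nhds
  rw [one_pow, mul_one] at hlim
  refine le_of_tendsto hlim ?_
  filter_upwards [Ioo_mem_nhdsLT (show (0 : ℝ) < 1 by norm_num)] with ρ hρ
  exact main ρ hρ.1.le hρ.2

/-- **Harnack's inequality** for a function with `F 0 = 1` and real part greater than `α`: apply the
Schwarz lemma to `(p - 1) / (p + 1)` with `p = (F - α) / (1 - α)`. -/
theorem harnack_le_re {F : ℂ → ℂ} {α : ℝ} (hα : α < 1) (hF : DifferentiableOn ℂ F unitDisk)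
    (hF0 : F 0 = 1) (hre : ∀ z ∈ unitDisk, α < (F z).re) {z : ℂ} (hz : z ∈ unitDisk) :
    α + (1 - α) * ((1 - ‖z‖) / (1 + ‖z‖)) ≤ (F z).re := by
  -- `q = (p - 1) / (p + 1)` after clearing the factor `1 - α`
  set q : ℂ → ℂ := fun z => (F z - 1) / (F z + 1 - 2 * α) with hq
  have hden : ∀ z ∈ unitDisk, F z + 1 - 2 * α ≠ 0 := by
    intro z hz h
    have := congrArg Complex.re h
    have h2 := hre z hz
    simp at this
    linarith
  have hqd : DifferentiableOn ℂ q unitDisk := by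
    refine DifferentiableOn.div (by fun_prop) (by fun_prop) hden
  have key : ∀ z ∈ unitDisk, ‖F z - 1‖ ^ 2 < ‖F z + 1 - 2 * α‖ ^ 2 := by
    intro z hz
    have h2 := hre z hz
    rw [← Complex.normSq_eq_norm_sq, ← Complex.normSq_eq_norm_sq, Complex.normSq_apply,
      Complex.normSq_apply]
    simp
    nlinarith [mul_pos (sub_pos.2 hα) (sub_pos.2 h2)]
  have hmaps : MapsTo q (ball 0 1) (ball 0 1) := by
    intro z hz
    have h1 := key z hz
    have h3 : ‖F z - 1‖ < ‖F z + 1 - 2 * α‖ := lt_of_pow_lt_pow_left₀ 2 (norm_nonneg _) h1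
    rw [mem_ball_zero_iff, hq]
    simp only [norm_div]
    rw [div_lt_one (lt_of_le_of_lt (norm_nonneg _) h3)]
    exact h3
  have hq0 : q 0 = 0 := by simp [hq, hF0]
  have hz1 := norm_lt_one_of_mem hz
  have hsch : ‖q z‖ ≤ ‖z‖ :=
    Complex.norm_le_norm_of_mapsTo_ball hqd (hmaps.mono_right ball_subset_closedBall) hq0 hz1
  rw [hq] at hsch
  simp only [norm_div] at hsch
  rw [div_le_iff₀ (norm_pos_iff.2 (hden z hz))] at hsch
  have hsq : ‖F z - 1‖ ^ 2 ≤ ‖z‖ ^ 2 * ‖F z + 1 - 2 * α‖ ^ 2 := by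
    rw [← mul_pow]; gcongr
  rw [← Complex.normSq_eq_norm_sq (F z - 1), ← Complex.normSq_eq_norm_sq (F z + 1 - 2 * α),
    Complex.normSq_apply, Complex.normSq_apply] at hsq
  simp at hsq
  have h2 := hre z hz
  set s := ‖z‖
  have hs0 : 0 ≤ s := norm_nonneg _
  set x := (F z).re
  set y := (F z).im
  -- with `u = x - α` and `v = 1 - α` the last inequality says `|u - v| ≤ s (u + v)`
  have h8 : (1 - α) - (x - α) ≤ s * ((x - α) + (1 - α)) := by
    have h9 : ((1 - α) - (x - α)) ^ 2 ≤ (s * ((x - α) + (1 - α))) ^ 2 := by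
      have : s ^ 2 * (y * y) ≤ 1 * (y * y) := by
        gcongr
        · exact mul_self_nonneg y
        · nlinarith
      nlinarith
    refine le_of_abs_le (abs_le_of_sq_le_sq h9 ?_)
    have : 0 ≤ (x - α) + (1 - α) := by linarith
    positivity
  have h10 : (1 - α) * ((1 - s) / (1 + s)) ≤ x - α := by
    rw [← mul_div_assoc, div_le_iff₀ (by positivity)]
    nlinarith
  linarith

/-! ### Integrals over disks -/

theorem continuous_circle_param :
    Continuous fun p : ℝ × ℝ => (p.1 : ℂ) * Complex.exp (p.2 * Complex.I) := by fun_prop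

/-- The integral of a function over a disk in polar coordinates. -/
theorem setLIntegral_ball_eq_polar {u : ℂ → ENNReal} {ρ : ℝ}
    (hu : ContinuousOn u (ball 0 ρ)) :
    ∫⁻ z in ball (0 : ℂ) ρ, u z =
      ∫⁻ s in Ioo 0 ρ, ∫⁻ t in Ioo (-Real.pi) Real.pi,
        ENNReal.ofReal s * u (s * Complex.exp (t * Complex.I)) := by
  rw [← lintegral_indicator measurableSet_ball, ← Complex.lintegral_comp_polarCoord_symm]
  have h1 : ∫⁻ p in polarCoord.target, ENNReal.ofReal p.1 •
        (ball (0 : ℂ) ρ).indicator u (Complex.polarCoord.symm p)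
      = ∫⁻ p in Ioo 0 ρ ×ˢ Ioo (-Real.pi) Real.pi,
        ENNReal.ofReal p.1 * u (p.1 * Complex.exp (p.2 * Complex.I)) := by
    rw [polarCoord_target, ← lintegral_indicator (measurableSet_Ioi.prod measurableSet_Ioo),
      ← lintegral_indicator (measurableSet_Ioo.prod measurableSet_Ioo)]
    congr 1
    funext p
    have hsymm : Complex.polarCoord.symm p = p.1 * Complex.exp (p.2 * Complex.I) := by
      rw [Complex.polarCoord_symm_apply, Complex.exp_mul_I]
      push_cast
      rfl
    simp only [indicator_apply (_ ×ˢ _), hsymm]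
    by_cases hp0 : 0 < p.1
    · by_cases hp1 : p.1 < ρ
      · have hmem : (p.1 : ℂ) * Complex.exp (p.2 * Complex.I) ∈ ball (0 : ℂ) ρ := by
          simpa [abs_of_pos hp0] using hp1
        simp [hp0, hp1, indicator_of_mem hmem]
      · have hmem : (p.1 : ℂ) * Complex.exp (p.2 * Complex.I) ∉ ball (0 : ℂ) ρ := by
          simpa [abs_of_pos hp0] using hp1
        simp [hp1, indicator_of_notMem hmem]
    · simp [hp0]
  rw [h1, Measure.volume_eq_prod, setLIntegral_prod]
  refine AEMeasurable.mul (by fun_prop)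
    (ContinuousOn.aemeasurable ?_ (measurableSet_Ioo.prod measurableSet_Ioo))
  refine hu.comp continuous_circle_param.continuousOn ?_
  rintro p ⟨hp, -⟩
  simp [abs_of_pos hp.1, hp.2]

/-- Parseval's identity on a disk. -/
theorem setLIntegral_ball_sq_norm {F : ℂ → ℂ} (hF : DifferentiableOn ℂ F unitDisk) {ρ : ℝ}
    (h0 : 0 ≤ ρ) (h1 : ρ < 1) :
    ∫⁻ z in ball (0 : ℂ) ρ, ENNReal.ofReal (‖F z‖ ^ 2) =
      ∑' n : ℕ, ENNReal.ofReal
        (Real.pi * (‖taylorCoeff F n‖ ^ 2 * (ρ ^ (2 * n + 2) / (n + 1)))) := by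
  have hpi := Real.pi_pos
  have hcont : ContinuousOn (fun z => ENNReal.ofReal (‖F z‖ ^ 2)) (ball 0 ρ) :=
    ENNReal.continuous_ofReal.comp_continuousOn
      ((hF.continuousOn.mono (ball_subset_ball h1.le)).norm.pow 2)
  rw [setLIntegral_ball_eq_polar hcont]
  have hinner : ∀ s ∈ Ioo 0 ρ, ∫⁻ t in Ioo (-Real.pi) Real.pi,
      ENNReal.ofReal s * ENNReal.ofReal (‖F (s * Complex.exp (t * Complex.I))‖ ^ 2)
      = ∑' n : ℕ, ENNReal.ofReal (2 * Real.pi * ‖taylorCoeff F n‖ ^ 2 * s ^ (2 * n + 1)) := by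
    intro s hs
    have hs1 : s < 1 := hs.2.trans h1
    have hP := hasSum_sq_taylorCoeff hF hs.1.le hs1
    have hc : Continuous fun t : ℝ => ‖F (s * Complex.exp (t * Complex.I))‖ ^ 2 :=
      (continuous_comp_circle hF hs.1.le hs1).norm.pow 2
    rw [lintegral_const_mul' _ _ ENNReal.ofReal_ne_top, ← ofReal_integral_eq_lintegral_ofReal
      ((hc.integrableOn_Icc (a := -Real.pi) (b := Real.pi)).mono_set Ioo_subset_Icc_self)
      (Filter.Eventually.of_forall fun t => by positivity), ← integral_Ioc_eq_integral_Ioo,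
      ← intervalIntegral.integral_of_le (by linarith), ← ENNReal.ofReal_mul hs.1.le]
    have hP2 := hP.mul_left s
    rw [← hP2.tsum_eq, ENNReal.ofReal_tsum_of_nonneg]
    · congr 1
      funext n
      congr 1
      ring
    · intro n
      have := hs.1
      positivity
    · exact hP2.summable
  rw [setLIntegral_congr_fun measurableSet_Ioo hinner, lintegral_tsum (fun n => by fun_prop)]
  congr 1
  funext n
  rw [← ofReal_integral_eq_lintegral_ofReal, ← integral_Ioc_eq_integral_Ioo,
    ← intervalIntegral.integral_of_le h0, intervalIntegral.integral_const_mul, integral_pow]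
  · congr 1
    push_cast
    have : (n : ℝ) + 1 ≠ 0 := by positivity
    field_simp
    ring
  · exact (Continuous.integrableOn_Icc (by fun_prop)).mono_set Ioo_subset_Icc_self
  · refine (ae_restrict_iff' measurableSet_Ioo).2 (Filter.Eventually.of_forall fun s hs => ?_)
    have := hs.1
    positivity

/-! ### The differential of a harmonic map and the area of the image -/

/-- The real differential `v ↦ a v + conj (b v)` of a harmonic map with `h' = a` and `g' = b`. -/
noncomputable def harmonicFDeriv (a b : ℂ) : ℂ →L[ℝ] ℂ :=
  ContinuousLinearMap.mul ℝ ℂ a +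
    (Complex.conjCLE : ℂ →L[ℝ] ℂ).comp (ContinuousLinearMap.mul ℝ ℂ b)

theorem harmonicFDeriv_apply (a b v : ℂ) :
    harmonicFDeriv a b v = a * v + (starRingEnd ℂ) (b * v) := by
  simp [harmonicFDeriv]

theorem det_harmonicFDeriv (a b : ℂ) : (harmonicFDeriv a b).det = ‖a‖ ^ 2 - ‖b‖ ^ 2 := by
  rw [ContinuousLinearMap.det, ← LinearMap.det_toMatrix Complex.basisOneI, Matrix.det_fin_two,
    ← Complex.normSq_eq_norm_sq, ← Complex.normSq_eq_norm_sq, Complex.normSq_apply,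
    Complex.normSq_apply]
  simp [LinearMap.toMatrix_apply, harmonicFDeriv_apply]
  ring

theorem differentiableOn_deriv {f : ℂ → ℂ} (hf : DifferentiableOn ℂ f unitDisk) :
    DifferentiableOn ℂ (deriv f) unitDisk :=
  hf.deriv isOpen_unitDisk

theorem hasStrictFDerivAt_harmonicMap {h g : ℂ → ℂ} (hh : DifferentiableOn ℂ h unitDisk)
    (hg : DifferentiableOn ℂ g unitDisk) {z : ℂ} (hz : z ∈ unitDisk) :
    HasStrictFDerivAt (harmonicMap h g) (harmonicFDeriv (deriv h z) (deriv g z)) z := by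
  have aux : ∀ {f : ℂ → ℂ}, DifferentiableOn ℂ f unitDisk →
      HasStrictFDerivAt f (ContinuousLinearMap.mul ℝ ℂ (deriv f z)) z := by
    intro f hf
    have h1 := (hf.analyticAt (isOpen_unitDisk.mem_nhds hz)).hasStrictDerivAt.hasStrictFDerivAt
    refine (h1.restrictScalars ℝ).congr_fderiv ?_
    ext v
    simp [mul_comm]
  exact (aux hh).add
    (((Complex.conjCLE : ℂ →L[ℝ] ℂ).hasStrictFDerivAt).comp z (aux hg))

/-- The upper bound for the area needs no injectivity, and the Jacobian `|h'|² - |g'|²` may be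
replaced by `|h'|²`. -/
theorem volume_image_ball_le {h g : ℂ → ℂ} (hh : DifferentiableOn ℂ h unitDisk)
    (hg : DifferentiableOn ℂ g unitDisk) (hlt : ∀ z ∈ unitDisk, ‖deriv g z‖ ≤ ‖deriv h z‖) {ρ : ℝ}
    (h1 : ρ < 1) :
    volume (harmonicMap h g '' ball 0 ρ) ≤
      ∫⁻ z in ball (0 : ℂ) ρ, ENNReal.ofReal (‖deriv h z‖ ^ 2) := by
  refine (addHaar_image_le_lintegral_abs_det_fderiv volume measurableSet_ball fun z hz =>
    ((hasStrictFDerivAt_harmonicMap hh hg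
      (ball_subset_ball h1.le hz)).hasFDerivAt.hasFDerivWithinAt)).trans ?_
  refine setLIntegral_mono' measurableSet_ball fun z hz => ENNReal.ofReal_le_ofReal ?_
  have h2 := hlt z (ball_subset_ball h1.le hz)
  rw [det_harmonicFDeriv, abs_of_nonneg]
  · nlinarith [sq_nonneg ‖deriv g z‖]
  · nlinarith [norm_nonneg (deriv g z)]

theorem volume_image_ball_eq {h : ℂ → ℂ} (hh : DifferentiableOn ℂ h unitDisk)
    {ρ : ℝ} (h1 : ρ < 1) (hinj : InjOn (harmonicMap h 0) (ball 0 ρ)) :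
    volume (harmonicMap h 0 '' ball 0 ρ) =
      ∫⁻ z in ball (0 : ℂ) ρ, ENNReal.ofReal (‖deriv h z‖ ^ 2) := by
  rw [← lintegral_abs_det_fderiv_eq_addHaar_image volume measurableSet_ball (fun z hz =>
    ((hasStrictFDerivAt_harmonicMap hh (g := 0) (differentiableOn_const 0)
      (ball_subset_ball h1.le hz)).hasFDerivAt.hasFDerivWithinAt)) hinj]
  refine setLIntegral_congr_fun measurableSet_ball fun z hz => ?_
  have hz0 : deriv (0 : ℂ → ℂ) z = 0 := by simp
  have : |(harmonicFDeriv (deriv h z) (deriv (0 : ℂ → ℂ) z)).det| = ‖deriv h z‖ ^ 2 := by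
    rw [det_harmonicFDeriv, hz0]
    simp
  exact congrArg ENNReal.ofReal this

/-! ### Coefficient and derivative bounds for the class -/

theorem exists_norm_eq_one_mul_eq_norm (w : ℂ) : ∃ l : ℂ, ‖l‖ = 1 ∧ l * w = ‖w‖ := by
  by_cases hw : w = 0
  · exact ⟨1, by simp, by simp [hw]⟩
  · have h1 : (‖w‖ : ℂ) ≠ 0 := by simpa using hw
    refine ⟨‖w‖ / w, ?_, by field_simp⟩
    rw [norm_div, Complex.norm_real, norm_norm, div_self (by simpa using hw)]

namespace IsClassPH0

variable {α : ℝ} {h g : ℂ → ℂ}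

theorem lt_re (H : IsClassPH0 α h g) {z : ℂ} (hz : z ∈ unitDisk) :
    ‖deriv g z‖ < (deriv h z).re - α := by
  simpa using H.re_gt z hz

/-- For unimodular `l`, the analytic function `h' + l g'` has real part greater than `α`. -/
theorem lt_re_add_mul (H : IsClassPH0 α h g) {l : ℂ} (hl : ‖l‖ = 1) {z : ℂ} (hz : z ∈ unitDisk) :
    α < (deriv h z + l * deriv g z).re := by
  have h1 := H.lt_re hz
  have h2 : -(l * deriv g z).re ≤ ‖l * deriv g z‖ :=
    (neg_le_abs _).trans (Complex.abs_re_le_norm _)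
  rw [norm_mul, hl, one_mul] at h2
  rw [Complex.add_re]
  linarith

theorem differentiableOn_add_mul (H : IsClassPH0 α h g) (l : ℂ) :
    DifferentiableOn ℂ (fun z => deriv h z + l * deriv g z) unitDisk :=
  (differentiableOn_deriv H.analytic_h).add ((differentiableOn_deriv H.analytic_g).const_mul l)

theorem add_mul_zero (H : IsClassPH0 α h g) (l : ℂ) : deriv h 0 + l * deriv g 0 = 1 := by
  rw [H.deriv_h_zero, H.deriv_g_zero]
  simp

/-- Choose `l` so that the `n`-th coefficient of `h' + l g'` has modulus
`(n + 1) (|a_{n+1}| + |b_{n+1}|)`, and apply Carathéodory's bound. -/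
theorem norm_taylorCoeff_deriv_add_le (H : IsClassPH0 α h g) {n : ℕ} (hn : n ≠ 0) :
    ‖taylorCoeff (deriv h) n‖ + ‖taylorCoeff (deriv g) n‖ ≤ 2 * (1 - α) := by
  obtain ⟨l₁, hl₁, e₁⟩ := exists_norm_eq_one_mul_eq_norm (taylorCoeff (deriv h) n)
  obtain ⟨l₂, hl₂, e₂⟩ := exists_norm_eq_one_mul_eq_norm (taylorCoeff (deriv g) n)
  have hne : l₁ ≠ 0 := by
    rintro rfl
    simp at hl₁
  have hl : ‖l₂ / l₁‖ = 1 := by rw [norm_div, hl₁, hl₂, div_one]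
  have hcoef : taylorCoeff (fun z => deriv h z + l₂ / l₁ * deriv g z) n
      = taylorCoeff (deriv h) n + l₂ / l₁ * taylorCoeff (deriv g) n := by
    refine taylorCoeff_eq_of_hasSum
      (c := fun n => taylorCoeff (deriv h) n + l₂ / l₁ * taylorCoeff (deriv g) n)
      (fun z hz => ?_) n
    have h1 := hasSum_taylorCoeff (differentiableOn_deriv H.analytic_h) hz
    have h2 := hasSum_taylorCoeff (differentiableOn_deriv H.analytic_g) hz
    convert h1.add (h2.mul_left (l₂ / l₁)) using 2 with n
    ring
  have key := norm_taylorCoeff_le (H.differentiableOn_add_mul (l₂ / l₁)) (H.add_mul_zero _)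
    (fun z hz => H.lt_re_add_mul hl hz) hn
  rw [hcoef] at key
  have h3 : l₁ * (taylorCoeff (deriv h) n + l₂ / l₁ * taylorCoeff (deriv g) n)
      = ((‖taylorCoeff (deriv h) n‖ + ‖taylorCoeff (deriv g) n‖ : ℝ) : ℂ) := by
    push_cast
    rw [← e₁, ← e₂]
    field_simp
  have h4 := congrArg norm h3
  rw [norm_mul, hl₁, one_mul, Complex.norm_real, Real.norm_of_nonneg (by positivity)] at h4
  rwa [h4] at key

theorem norm_taylorCoeff_add_le (H : IsClassPH0 α h g) {n : ℕ} (hn : 2 ≤ n) :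
    ‖taylorCoeff h n‖ + ‖taylorCoeff g n‖ ≤ 2 * (1 - α) / n := by
  obtain ⟨m, rfl⟩ : ∃ m, n = m + 1 := ⟨n - 1, by omega⟩
  have key := H.norm_taylorCoeff_deriv_add_le (n := m) (by omega)
  rw [taylorCoeff_deriv, taylorCoeff_deriv, norm_mul, norm_mul, ← mul_add] at key
  have h1 : ‖(m + 1 : ℂ)‖ = (m + 1 : ℝ) := by
    have := Complex.norm_natCast (m + 1)
    push_cast at this
    exact this
  rw [h1] at key
  rw [le_div_iff₀ (by positivity)]
  push_cast
  linarith

/-- Harnack's inequality for `h' + l g'`, where `l` is chosen so that `l g'(z) = -|g'(z)|`. -/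
theorem harnack (H : IsClassPH0 α h g) (hα : α < 1) {z : ℂ} (hz : z ∈ unitDisk) :
    α + (1 - α) * ((1 - ‖z‖) / (1 + ‖z‖)) ≤ (deriv h z).re - ‖deriv g z‖ := by
  obtain ⟨l, hl, e⟩ := exists_norm_eq_one_mul_eq_norm (deriv g z)
  have hl' : ‖-l‖ = 1 := by rwa [norm_neg]
  have key := harnack_le_re hα (H.differentiableOn_add_mul (-l)) (H.add_mul_zero _)
    (fun z hz => H.lt_re_add_mul hl' hz) hz
  rw [neg_mul, e] at key
  simpa [sub_eq_add_neg] using key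

/-! ### Monotonicity along rays -/

/-- In the direction `e`, the component of `f` along `e` grows at least at the rate
`Re h' - |g'|`. -/
theorem sub_le_re_mul_conj (H : IsClassPH0 α h g) {z₀ e : ℂ} (he : ‖e‖ = 1) {a b : ℝ}
    (hab : a ≤ b) (hseg : ∀ t ∈ Icc a b, z₀ + t * e ∈ unitDisk) {K k : ℝ → ℝ}
    (hK : ∀ t ∈ Icc a b, HasDerivAt K (k t) t)
    (hk : ∀ t ∈ Icc a b, k t ≤ (deriv h (z₀ + t * e)).re - ‖deriv g (z₀ + t * e)‖) :
    K b - K a ≤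
      ((harmonicMap h g (z₀ + b * e) - harmonicMap h g (z₀ + a * e)) * (starRingEnd ℂ) e).re := by
  set φ : ℝ → ℝ := fun t => (harmonicMap h g (z₀ + t * e) * (starRingEnd ℂ) e).re - K t with hφ
  have hder : ∀ t ∈ Icc a b, HasDerivAt φ
      ((harmonicFDeriv (deriv h (z₀ + t * e)) (deriv g (z₀ + t * e)) e
        * (starRingEnd ℂ) e).re - k t) t := by
    intro t ht
    have h1 : HasDerivAt (fun t : ℝ => z₀ + t * e) e t := by
      simpa using (((hasDerivAt_id t).ofReal_comp).mul_const e).const_add z₀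
    have h2 := (hasStrictFDerivAt_harmonicMap H.analytic_h H.analytic_g
      (hseg t ht)).hasFDerivAt.comp_hasDerivAt t h1
    have h3 := Complex.reCLM.hasFDerivAt.comp_hasDerivAt t (h2.mul_const ((starRingEnd ℂ) e))
    exact h3.sub (hK t ht)
  have hmono : MonotoneOn φ (Icc a b) := by
    refine monotoneOn_of_deriv_nonneg (convex_Icc a b)
      (fun t ht => (hder t ht).continuousAt.continuousWithinAt)
      (fun t ht => (hder t (interior_subset ht)).differentiableAt.differentiableWithinAt)
      fun t ht => ?_
    have ht' := interior_subset ht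
    rw [(hder t ht').deriv, harmonicFDeriv_apply]
    have h5 := hk t ht'
    set A := deriv h (z₀ + t * e)
    set B := deriv g (z₀ + t * e)
    have h6 : (A * e + (starRingEnd ℂ) (B * e)) * (starRingEnd ℂ) e
        = A + (starRingEnd ℂ) (B * e * e) := by
      have : e * (starRingEnd ℂ) e = 1 := by
        rw [Complex.mul_conj, Complex.normSq_eq_norm_sq, he]; simp
      rw [add_mul, mul_assoc, this, mul_one, ← map_mul]
    have h7 : -((starRingEnd ℂ) (B * e * e)).re ≤ ‖B‖ := by
      refine ((neg_le_abs _).trans (Complex.abs_re_le_norm _)).trans ?_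
      rw [RCLike.norm_conj, norm_mul, norm_mul, he]; simp
    rw [h6, Complex.add_re]
    linarith
  have := hmono (left_mem_Icc.2 hab) (right_mem_Icc.2 hab) hab
  simp only [hφ] at this
  rw [sub_mul, Complex.sub_re]
  linarith

theorem re_mul_conj_le_norm {w e : ℂ} (he : ‖e‖ = 1) : (w * (starRingEnd ℂ) e).re ≤ ‖w‖ := by
  refine (Complex.re_le_norm _).trans_eq ?_
  rw [norm_mul, RCLike.norm_conj, he, mul_one]

/-- The image of `z₀` is separated from the image of the complement of a neighbourhood of `z₀`:
along every ray from `z₀` the map moves monotonically outwards. -/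
theorem exists_pos_le_norm_sub (H : IsClassPH0 α h g) (hα : 0 ≤ α) {z₀ : ℂ} {δ : ℝ} (hδ : 0 < δ)
    (hball : closedBall z₀ δ ⊆ unitDisk) :
    ∃ m > 0, ∀ z ∈ unitDisk, δ ≤ ‖z - z₀‖ → m ≤ ‖harmonicMap h g z - harmonicMap h g z₀‖ := by
  have hcont : ContinuousOn (fun z => (deriv h z).re - ‖deriv g z‖) (closedBall z₀ δ) :=
    ((Complex.continuous_re.comp_continuousOn
      (differentiableOn_deriv H.analytic_h).continuousOn).sub
      (differentiableOn_deriv H.analytic_g).continuousOn.norm).mono hball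
  obtain ⟨x, hx, hmin⟩ := (isCompact_closedBall z₀ δ).exists_isMinOn
    ⟨z₀, mem_closedBall_self hδ.le⟩ hcont
  set c := (deriv h x).re - ‖deriv g x‖ with hc
  have hc0 : 0 < c := by
    have := H.lt_re (hball hx)
    linarith
  have hz₀ : z₀ ∈ unitDisk := hball (mem_closedBall_self hδ.le)
  refine ⟨c * δ, by positivity, fun z hz hzδ => ?_⟩
  set s := ‖z - z₀‖ with hs
  have hs0 : 0 < s := hδ.trans_le hzδ
  have hs0' : (s : ℂ) ≠ 0 := by exact_mod_cast hs0.ne'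
  set e : ℂ := (z - z₀) / s with he_def
  have he : ‖e‖ = 1 := by
    rw [he_def, norm_div, Complex.norm_real, Real.norm_of_nonneg hs0.le, div_self hs0.ne']
  have hseg : ∀ t ∈ Icc 0 s, z₀ + t * e ∈ unitDisk := by
    intro t ht
    have h1 : z₀ + (t / s) • (z - z₀) ∈ unitDisk := (convex_ball (0 : ℂ) 1).add_smul_sub_mem hz₀ hz
      (t := t / s) ⟨div_nonneg ht.1 hs0.le, (div_le_one hs0).2 ht.2⟩
    convert h1 using 2
    rw [he_def, Complex.real_smul]
    push_cast
    ring
  -- the gain is at least `c δ` inside the small disk, and nonnegative from there on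
  have h1 := H.sub_le_re_mul_conj (z₀ := z₀) he hδ.le
    (fun t ht => hseg t ⟨ht.1, ht.2.trans hzδ⟩) (K := fun t => c * t) (k := fun _ => c)
    (fun t _ => by simpa using (hasDerivAt_id t).const_mul c) (fun t ht => by
      refine hmin (a := z₀ + t * e) ?_
      rw [mem_closedBall, dist_eq_norm, add_sub_cancel_left, norm_mul, he, mul_one,
        Complex.norm_real, Real.norm_of_nonneg ht.1]
      exact ht.2)
  have h2 := H.sub_le_re_mul_conj (z₀ := z₀) he hzδ
    (fun t ht => hseg t ⟨hδ.le.trans ht.1, ht.2⟩) (K := fun _ => 0) (k := fun _ => 0)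
    (fun t _ => hasDerivAt_const t 0) (fun t ht => by
      have := H.lt_re (hseg t ⟨hδ.le.trans ht.1, ht.2⟩)
      linarith)
  have hend : z₀ + s * e = z := by
    rw [he_def]; field_simp; ring
  have h3 := re_mul_conj_le_norm (w := harmonicMap h g z - harmonicMap h g z₀) he
  rw [hend] at h2
  simp only [Complex.ofReal_zero, zero_mul, add_zero, mul_zero, sub_zero, sub_mul,
    Complex.sub_re] at h1 h2 h3
  linarith

theorem exists_closedBall_subset {z₀ : ℂ} (hz₀ : z₀ ∈ unitDisk) {ε : ℝ} (hε : 0 < ε) :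
    ∃ δ > 0, δ ≤ ε ∧ closedBall z₀ δ ⊆ unitDisk := by
  obtain ⟨r, hr, hsub⟩ := nhds_basis_closedBall.mem_iff.1 (isOpen_unitDisk.mem_nhds hz₀)
  exact ⟨min r ε, lt_min hr hε, min_le_right _ _,
    (closedBall_subset_closedBall (min_le_left _ _)).trans hsub⟩

theorem injOn (H : IsClassPH0 α h g) (hα : 0 ≤ α) : InjOn (harmonicMap h g) unitDisk := by
  intro z hz w hw hzw
  by_contra hne
  obtain ⟨δ, hδ, hle, hsub⟩ := exists_closedBall_subset hw (norm_pos_iff.2 (sub_ne_zero.2 hne))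
  obtain ⟨m, hm, hsep⟩ := H.exists_pos_le_norm_sub hα hδ hsub
  have := hsep z hz hle
  rw [hzw, sub_self, norm_zero] at this
  linarith

/-- The differential is invertible since `|g'| < |h'|`, so the map is open. -/
theorem isOpen_image (H : IsClassPH0 α h g) (hα : 0 ≤ α) :
    IsOpen (harmonicMap h g '' unitDisk) := by
  rw [isOpen_iff_mem_nhds]
  rintro _ ⟨z, hz, rfl⟩
  have hlt : ‖deriv g z‖ < ‖deriv h z‖ := by
    have h1 := H.lt_re hz
    have h2 := Complex.re_le_norm (deriv h z)
    linarith
  have hsurj : (harmonicFDeriv (deriv h z) (deriv g z)).range = ⊤ := by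
    rw [LinearMap.range_eq_top]
    refine LinearMap.surjective_of_injective ?_
    rw [← LinearMap.ker_eq_bot, LinearMap.ker_eq_bot']
    intro v hv
    have hv' : deriv h z * v + (starRingEnd ℂ) (deriv g z * v) = 0 := by
      rw [← harmonicFDeriv_apply]; exact hv
    have h3 := congrArg norm (eq_neg_of_add_eq_zero_left hv')
    rw [norm_neg, RCLike.norm_conj, norm_mul, norm_mul] at h3
    by_contra hv0
    have := norm_pos_iff.2 hv0
    nlinarith
  rw [← (hasStrictFDerivAt_harmonicMap H.analytic_h H.analytic_g hz).map_nhds_eq_of_surj hsurj]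
  exact Filter.image_mem_map (isOpen_unitDisk.mem_nhds hz)

/-- Limits of the map along sequences that approach the unit circle are boundary points of the
image. -/
theorem mem_frontier_of_tendsto (H : IsClassPH0 α h g) (hα : 0 ≤ α) {u : ℕ → ℂ}
    (hu : ∀ n, u n ∈ unitDisk) (hu1 : Filter.Tendsto (fun n => ‖u n‖) Filter.atTop (nhds 1)) {w : ℂ}
    (hw : Filter.Tendsto (fun n => harmonicMap h g (u n)) Filter.atTop (nhds w)) :
    w ∈ frontier (harmonicMap h g '' unitDisk) := by
  refine ⟨mem_closure_of_tendsto hw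
    (Filter.Eventually.of_forall fun n => mem_image_of_mem _ (hu n)),
    fun hwi => ?_⟩
  obtain ⟨z₀, hz₀, rfl⟩ := interior_subset hwi
  have hz₀1 := norm_lt_one_of_mem hz₀
  obtain ⟨δ, hδ, hle, hsub⟩ := exists_closedBall_subset hz₀
    (show 0 < (1 - ‖z₀‖) / 2 by linarith)
  obtain ⟨m, hm, hsep⟩ := H.exists_pos_le_norm_sub hα hδ hsub
  have h1 : ∀ᶠ n in Filter.atTop, (1 + ‖z₀‖) / 2 < ‖u n‖ :=
    hu1.eventually_const_lt (by linarith)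
  have h2 : ∀ᶠ n in Filter.atTop, dist (harmonicMap h g (u n)) (harmonicMap h g z₀) < m :=
    (tendsto_iff_dist_tendsto_zero.1 hw).eventually_lt_const hm
  obtain ⟨n, hn1, hn2⟩ := (h1.and h2).exists
  have h3 := norm_sub_norm_le (u n) z₀
  have h4 := hsep (u n) (hu n) (by linarith)
  rw [dist_eq_norm] at hn2
  linarith

end IsClassPH0

/-! ### Growth of maps of the class -/

/-- The lower growth bound `∫₀ᵗ (α + (1 - α) (1 - s) / (1 + s)) ds` for maps of the class. -/
noncomputable def growthBound (α t : ℝ) : ℝ := (2 * α - 1) * t + 2 * (1 - α) * Real.log (1 + t)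

theorem hasDerivAt_growthBound (α : ℝ) {t : ℝ} (ht : 0 ≤ t) :
    HasDerivAt (growthBound α) (α + (1 - α) * ((1 - t) / (1 + t))) t := by
  have h0 : 1 + t ≠ 0 := by positivity
  have h1 : HasDerivAt (fun t : ℝ => 1 + t) 1 t := (hasDerivAt_id t).const_add 1
  have h2 := ((hasDerivAt_id t).const_mul (2 * α - 1)).add ((h1.log h0).const_mul (2 * (1 - α)))
  refine h2.congr_deriv ?_
  field_simp
  ring

theorem growthBound_zero (α : ℝ) : growthBound α 0 = 0 := by simp [growthBound]

theorem growthBound_one (α : ℝ) : growthBound α 1 = 1 + 2 * (1 - α) * (Real.log 2 - 1) := by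
  rw [growthBound, one_add_one_eq_two]
  ring

theorem exists_seq_tendsto_one :
    ∃ ρ : ℕ → ℝ, (∀ n, 0 ≤ ρ n) ∧ (∀ n, ρ n < 1) ∧ Filter.Tendsto ρ Filter.atTop (nhds 1) := by
  obtain ⟨ρ, -, hρ, hlim⟩ := exists_seq_strictMono_tendsto' (zero_lt_one' ℝ)
  exact ⟨ρ, fun n => (hρ n).1.le, fun n => (hρ n).2, hlim⟩

namespace IsClassPH0

variable {α : ℝ} {h g : ℂ → ℂ}

theorem harmonicMap_zero (H : IsClassPH0 α h g) : harmonicMap h g 0 = 0 := by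
  simp [harmonicMap, H.h_zero, H.g_zero]

theorem growthBound_le_norm (H : IsClassPH0 α h g) (hα : α < 1) {z : ℂ} (hz : z ∈ unitDisk) :
    growthBound α ‖z‖ ≤ ‖harmonicMap h g z‖ := by
  by_cases hz0 : z = 0
  · rw [hz0, norm_zero, growthBound_zero]
    exact norm_nonneg _
  set s := ‖z‖ with hs
  have hs0 : 0 < s := norm_pos_iff.2 hz0
  have hs1 : s < 1 := norm_lt_one_of_mem hz
  have hs0' : (s : ℂ) ≠ 0 := by exact_mod_cast hs0.ne'
  have he : ‖z / s‖ = 1 := by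
    rw [norm_div, Complex.norm_real, Real.norm_of_nonneg hs0.le, div_self hs0.ne']
  have hn : ∀ t ∈ Icc 0 s, ‖(0 : ℂ) + t * (z / s)‖ = t := by
    intro t ht
    rw [zero_add, norm_mul, he, mul_one, Complex.norm_real, Real.norm_of_nonneg ht.1]
  have hseg : ∀ t ∈ Icc 0 s, (0 : ℂ) + t * (z / s) ∈ unitDisk := fun t ht =>
    mem_unitDisk (by rw [hn t ht]; exact ht.2.trans_lt hs1)
  have key := H.sub_le_re_mul_conj he hs0.le hseg (K := growthBound α)
    (fun t ht => hasDerivAt_growthBound α ht.1) (fun t ht => by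
      have := H.harnack hα (hseg t ht)
      rwa [hn t ht] at this)
  have hend : (s : ℂ) * (z / s) = z := by field_simp
  have h3 := re_mul_conj_le_norm (w := harmonicMap h g z) he
  simp only [zero_add, hend, Complex.ofReal_zero, zero_mul, H.harmonicMap_zero, sub_zero,
    growthBound_zero] at key
  linarith

/-- At `n = 0` the right-hand sides are `0`, and so are the coefficients. -/
theorem norm_taylorCoeff_sq_le (H : IsClassPH0 α h g) (hα : 0 ≤ α) (n : ℕ) :
    ‖taylorCoeff h n‖ ^ 2 ≤ 4 * (1 / (n : ℝ) ^ 2) ∧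
      ‖taylorCoeff g n‖ ^ 2 ≤ 4 * (1 / (n : ℝ) ^ 2) := by
  have hbd : ∀ x : ℝ, 0 ≤ x → x ≤ 2 / n → x ^ 2 ≤ 4 * (1 / (n : ℝ) ^ 2) := by
    intro x hx0 hx
    calc x ^ 2 ≤ (2 / n) ^ 2 := by gcongr
      _ = _ := by rw [div_pow]; ring
  match n, hbd with
  | 0, _ => simp [taylorCoeff_zero, H.h_zero, H.g_zero]
  | 1, hbd =>
    simp [taylorCoeff_one, H.deriv_h_zero, H.deriv_g_zero]
  | n + 2, hbd =>
    have h1 := H.norm_taylorCoeff_add_le (n := n + 2) (by omega)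
    have h2 : 2 * (1 - α) / ((n + 2 : ℕ) : ℝ) ≤ 2 / ((n + 2 : ℕ) : ℝ) := by
      gcongr
      linarith
    exact ⟨hbd _ (norm_nonneg _) (by linarith [norm_nonneg (taylorCoeff g (n + 2))]),
      hbd _ (norm_nonneg _) (by linarith [norm_nonneg (taylorCoeff h (n + 2))])⟩

/-! ### The boundary of the image -/

/-- The coefficient bounds make the quadratic means of the map over circles bounded, so the map
stays bounded along some sequence that approaches the unit circle. -/
theorem exists_norm_sq_le (H : IsClassPH0 α h g) (hα : 0 ≤ α) :
    ∃ B : ℝ, ∀ ρ : ℝ, 0 ≤ ρ → ρ < 1 → ∃ z : ℂ, ‖z‖ = ρ ∧ ‖harmonicMap h g z‖ ^ 2 ≤ B := by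
  have hpi := Real.pi_pos
  have hT : Summable fun n : ℕ => 4 * (1 / (n : ℝ) ^ 2) :=
    (Real.summable_one_div_nat_pow.2 one_lt_two).mul_left 4
  set T := ∑' n : ℕ, 4 * (1 / (n : ℝ) ^ 2)
  refine ⟨4 * T + 1, fun ρ h0 h1 => ?_⟩
  by_contra! hcon
  have mean : ∀ {u : ℂ → ℂ}, DifferentiableOn ℂ u unitDisk →
      (∀ n, ‖taylorCoeff u n‖ ^ 2 ≤ 4 * (1 / (n : ℝ) ^ 2)) →
      ∫ t in -Real.pi..Real.pi, ‖u (ρ * Complex.exp (t * Complex.I))‖ ^ 2 ≤ 2 * Real.pi * T := by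
    intro u hu hc
    refine hasSum_le (fun n => ?_) (hasSum_sq_taylorCoeff hu h0 h1) (hT.hasSum.mul_left _)
    have : ρ ^ (2 * n) ≤ 1 := pow_le_one₀ h0 h1.le
    refine mul_le_mul_of_nonneg_left ?_ (by positivity)
    calc ‖taylorCoeff u n‖ ^ 2 * ρ ^ (2 * n) ≤ ‖taylorCoeff u n‖ ^ 2 * 1 := by gcongr
      _ ≤ _ := by rw [mul_one]; exact hc n
  have mh := mean H.analytic_h fun n => (H.norm_taylorCoeff_sq_le hα n).1
  have mg := mean H.analytic_g fun n => (H.norm_taylorCoeff_sq_le hα n).2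
  have ch := continuous_comp_circle H.analytic_h h0 h1
  have cg := continuous_comp_circle H.analytic_g h0 h1
  have ih : IntervalIntegrable (fun t : ℝ => 2 * ‖h (ρ * Complex.exp (t * Complex.I))‖ ^ 2)
      volume (-Real.pi) Real.pi := ((ch.norm.pow 2).const_mul 2).intervalIntegrable _ _
  have ig : IntervalIntegrable (fun t : ℝ => 2 * ‖g (ρ * Complex.exp (t * Complex.I))‖ ^ 2)
      volume (-Real.pi) Real.pi := ((cg.norm.pow 2).const_mul 2).intervalIntegrable _ _
  have hle : ∫ t in -Real.pi..Real.pi, (4 * T + 1) ≤ ∫ t in -Real.pi..Real.pi,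
      (2 * ‖h (ρ * Complex.exp (t * Complex.I))‖ ^ 2
        + 2 * ‖g (ρ * Complex.exp (t * Complex.I))‖ ^ 2) := by
    refine intervalIntegral.integral_mono (by linarith) (by simp)
      (ih.add ig) fun t => ?_
    set z : ℂ := ρ * Complex.exp (t * Complex.I)
    have hz : ‖z‖ = ρ := by simp [z, abs_of_nonneg h0]
    have h2 := hcon z hz
    have h3 : ‖harmonicMap h g z‖ ≤ ‖h z‖ + ‖g z‖ :=
      (norm_add_le _ _).trans_eq (by rw [RCLike.norm_conj])
    have h4 : ‖harmonicMap h g z‖ ^ 2 ≤ (‖h z‖ + ‖g z‖) ^ 2 := by gcongr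
    show 4 * T + 1 ≤ 2 * ‖h z‖ ^ 2 + 2 * ‖g z‖ ^ 2
    nlinarith [sq_nonneg (‖h z‖ - ‖g z‖)]
  rw [intervalIntegral.integral_const, smul_eq_mul, intervalIntegral.integral_add ih ig,
    intervalIntegral.integral_const_mul, intervalIntegral.integral_const_mul] at hle
  nlinarith

/-- The image is not the whole plane. A limit value of the map along a sequence that approaches the
unit circle lies on the boundary, and such values exist since the map does not tend to infinity. -/
theorem nonempty_frontier (H : IsClassPH0 α h g) (hα : 0 ≤ α) :
    (frontier (harmonicMap h g '' unitDisk)).Nonempty := by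
  obtain ⟨B, hB⟩ := H.exists_norm_sq_le hα
  obtain ⟨ρ, hρ0, hρ1, hρ⟩ := exists_seq_tendsto_one
  choose z hz hzB using fun n : ℕ => hB (ρ n) (hρ0 n) (hρ1 n)
  have hbd : ∀ n, harmonicMap h g (z n) ∈ closedBall (0 : ℂ) (Real.sqrt B) := fun n => by
    rw [mem_closedBall_zero_iff]
    exact Real.le_sqrt_of_sq_le (hzB n)
  obtain ⟨w, -, φ, hφ, hlim⟩ := tendsto_subseq_of_bounded isBounded_closedBall hbd
  have hnorm : Filter.Tendsto (fun n => ‖z n‖) Filter.atTop (nhds 1) := by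
    simpa only [hz] using hρ
  exact ⟨w, H.mem_frontier_of_tendsto hα (u := z ∘ φ)
    (fun n => mem_unitDisk (by simp only [Function.comp_apply, hz]; exact hρ1 _))
    (hnorm.comp hφ.tendsto_atTop) hlim⟩

/-- A boundary point is a limit of values `f (z n)` where the `z n` accumulate only on the unit
circle, because `f` is open; there the growth bound tends to `growthBound α 1`. -/
theorem growthBound_one_le_boundaryDist (H : IsClassPH0 α h g) (hα0 : 0 ≤ α) (hα1 : α < 1) :
    growthBound α 1 ≤ boundaryDist (harmonicMap h g) := by
  rw [boundaryDist, le_infDist (H.nonempty_frontier hα0), H.harmonicMap_zero]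
  intro w hw
  rw [dist_zero_left]
  obtain ⟨x, hx, hxw⟩ := mem_closure_iff_seq_limit.1 (frontier_subset_closure hw)
  choose z hz hzx using hx
  obtain ⟨z', hz', φ, hφ, hlim⟩ := (isCompact_closedBall (0 : ℂ) 1).tendsto_subseq
    fun n => ball_subset_closedBall (hz n)
  have hflim : Filter.Tendsto (fun n => harmonicMap h g (z (φ n))) Filter.atTop (nhds w) := by
    simp only [hzx]
    exact hxw.comp hφ.tendsto_atTop
  rw [mem_closedBall_zero_iff] at hz'
  rcases hz'.lt_or_eq with hlt | heq
  · have hmem := mem_unitDisk hlt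
    have hc := (hasStrictFDerivAt_harmonicMap H.analytic_h H.analytic_g hmem).continuousAt
    have hw' : w = harmonicMap h g z' := tendsto_nhds_unique hflim (hc.tendsto.comp hlim)
    have := hw.2
    rw [(H.isOpen_image hα0).interior_eq, hw'] at this
    exact absurd (mem_image_of_mem _ hmem) this
  · have h1 : Filter.Tendsto (fun n => growthBound α ‖z (φ n)‖) Filter.atTop
        (nhds (growthBound α ‖z'‖)) :=
      (hasDerivAt_growthBound α (norm_nonneg z')).continuousAt.tendsto.comp hlim.norm
    rw [heq] at h1
    exact le_of_tendsto_of_tendsto' h1 hflim.norm fun n => H.growthBound_le_norm hα1 (hz (φ n))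

end IsClassPH0

/-! ### Majorant series, area and the radius function -/

theorem hasSum_pow_div_nat_add_two {r : ℝ} (h0 : 0 ≤ r) (h1 : r < 1) :
    HasSum (fun n : ℕ => r ^ (n + 2) / (n + 2 : ℝ)) (-(r + Real.log (1 - r))) := by
  have h := Real.hasSum_pow_div_log_of_abs_lt_one (x := r) (by rwa [abs_of_nonneg h0])
  have h2 := (hasSum_nat_add_iff' 1).2 h
  have e : -(r + Real.log (1 - r))
      = -Real.log (1 - r) - ∑ i ∈ Finset.range 1, r ^ (i + 1) / (i + 1 : ℝ) := by
    simp; ring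
  rw [e]
  refine h2.congr_fun fun n => ?_
  push_cast
  ring

theorem hasSum_majorant_bound (α : ℝ) {r : ℝ} (h0 : 0 ≤ r) (h1 : r < 1) :
    HasSum (fun n : ℕ => 2 * (1 - α) / ((n + 2 : ℕ) : ℝ) * r ^ (n + 2))
      (-(2 * (1 - α) * (r + Real.log (1 - r)))) := by
  have e : -(2 * (1 - α) * (r + Real.log (1 - r))) = 2 * (1 - α) * -(r + Real.log (1 - r)) := by
    ring
  rw [e]
  refine ((hasSum_pow_div_nat_add_two h0 h1).mul_left (2 * (1 - α))).congr_fun fun n => ?_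
  push_cast
  ring

/-- The value of the area integral when the coefficients of `h'` have modulus `1` at order zero and
`2 (1 - α)` at every positive order. -/
theorem tsum_area_bound (α : ℝ) {r : ℝ} (h0 : 0 ≤ r) (h1 : r < 1) :
    ∑' n : ℕ, ENNReal.ofReal (Real.pi *
        ((if n = 0 then 1 else 2 * (1 - α)) ^ 2 * (r ^ (2 * n + 2) / (n + 1)))) =
      ENNReal.ofReal (Real.pi *
        (r ^ 2 - 4 * (1 - α) ^ 2 * (r ^ 2 + Real.log (1 - r ^ 2)))) := by
  have hs : HasSum (fun n : ℕ => Real.pi *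
      ((if n = 0 then 1 else 2 * (1 - α)) ^ 2 * (r ^ (2 * n + 2) / (n + 1))))
      (Real.pi * (r ^ 2 - 4 * (1 - α) ^ 2 * (r ^ 2 + Real.log (1 - r ^ 2)))) := by
    refine HasSum.mul_left _ ?_
    rw [← hasSum_nat_add_iff' 1]
    have h2 := (hasSum_pow_div_nat_add_two (r := r ^ 2) (by positivity)
      (pow_lt_one₀ h0 h1 two_ne_zero)).mul_left (4 * (1 - α) ^ 2)
    have e : r ^ 2 - 4 * (1 - α) ^ 2 * (r ^ 2 + Real.log (1 - r ^ 2)) -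
        ∑ i ∈ Finset.range 1,
          (if i = 0 then 1 else 2 * (1 - α)) ^ 2 * (r ^ (2 * i + 2) / ((i : ℝ) + 1))
        = 4 * (1 - α) ^ 2 * -(r ^ 2 + Real.log (1 - r ^ 2)) := by
      simp
      ring
    rw [e]
    refine h2.congr_fun fun n => ?_
    rw [if_neg (by omega), ← pow_mul]
    push_cast
    ring
  rw [← hs.tsum_eq, ENNReal.ofReal_tsum_of_nonneg (fun n => by positivity) hs.summable]

theorem toReal_ofReal_area_div_pi (α : ℝ) {r : ℝ} (h0 : 0 ≤ r) (h1 : r < 1) :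
    (ENNReal.ofReal (Real.pi *
        (r ^ 2 - 4 * (1 - α) ^ 2 * (r ^ 2 + Real.log (1 - r ^ 2))))).toReal / Real.pi
      = r ^ 2 - 4 * (1 - α) ^ 2 * (r ^ 2 + Real.log (1 - r ^ 2)) := by
  have hlog : Real.log (1 - r ^ 2) ≤ (1 - r ^ 2) - 1 :=
    Real.log_le_sub_one_of_pos (by nlinarith)
  have hnn : 0 ≤ r ^ 2 - 4 * (1 - α) ^ 2 * (r ^ 2 + Real.log (1 - r ^ 2)) := by
    have : 0 ≤ 4 * (1 - α) ^ 2 * (-(r ^ 2 + Real.log (1 - r ^ 2))) :=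
      mul_nonneg (by positivity) (by linarith)
    nlinarith [sq_nonneg r]
  rw [ENNReal.toReal_ofReal (mul_nonneg Real.pi_pos.le hnn), mul_div_cancel_left₀ _ Real.pi_ne_zero]

namespace IsClassPH0

variable {α : ℝ} {h g : ℂ → ℂ}

theorem majorantTerm_le (H : IsClassPH0 α h g) {r : ℝ} (h0 : 0 ≤ r) (n : ℕ) :
    majorantTerm h g r (n + 2) ≤ 2 * (1 - α) / ((n + 2 : ℕ) : ℝ) * r ^ (n + 2) := by
  unfold majorantTerm
  gcongr
  exact H.norm_taylorCoeff_add_le (by omega)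

theorem summable_majorantTerm (H : IsClassPH0 α h g) {r : ℝ} (h0 : 0 ≤ r) (h1 : r < 1) :
    Summable fun n : ℕ => majorantTerm h g r (n + 2) :=
  Summable.of_nonneg_of_le (fun n => by unfold majorantTerm; positivity)
    (fun n => H.majorantTerm_le h0 n) (hasSum_majorant_bound α h0 h1).summable

theorem imageArea_div_pi_le (H : IsClassPH0 α h g) (hα : 0 ≤ α) {r : ℝ} (h0 : 0 ≤ r)
    (h1 : r < 1) :
    imageArea (harmonicMap h g) r / Real.pi
      ≤ r ^ 2 - 4 * (1 - α) ^ 2 * (r ^ 2 + Real.log (1 - r ^ 2)) := by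
  have hle : volume (harmonicMap h g '' ball 0 r) ≤ ENNReal.ofReal (Real.pi *
      (r ^ 2 - 4 * (1 - α) ^ 2 * (r ^ 2 + Real.log (1 - r ^ 2)))) := by
    refine (volume_image_ball_le H.analytic_h H.analytic_g (fun z hz => ?_) h1).trans ?_
    · have h2 := H.lt_re hz
      have h3 := Complex.re_le_norm (deriv h z)
      linarith
    · rw [setLIntegral_ball_sq_norm (differentiableOn_deriv H.analytic_h) h0 h1,
        ← tsum_area_bound α h0 h1]
      refine ENNReal.tsum_le_tsum fun n => ENNReal.ofReal_le_ofReal ?_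
      have : ‖taylorCoeff (deriv h) n‖ ≤ if n = 0 then 1 else 2 * (1 - α) := by
        split_ifs with hn
        · rw [hn, taylorCoeff_zero, H.deriv_h_zero, norm_one]
        · have := H.norm_taylorCoeff_deriv_add_le hn
          linarith [norm_nonneg (taylorCoeff (deriv g) n)]
      gcongr
  rw [← toReal_ofReal_area_div_pi α h0 h1, imageArea]
  gcongr
  exact ENNReal.ofReal_ne_top

theorem bohrAreaSum_le (H : IsClassPH0 α h g) (hα : 0 ≤ α) {r : ℝ} (h0 : 0 ≤ r) (h1 : r < 1) :
    bohrAreaSum h g r ≤ radiusFun α r + growthBound α 1 := by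
  have h2 := H.imageArea_div_pi_le hα h0 h1
  have h3 := hasSum_le (fun n => H.majorantTerm_le h0 n) (H.summable_majorantTerm h0 h1).hasSum
    (hasSum_majorant_bound α h0 h1)
  rw [bohrAreaSum, radiusFun, growthBound_one]
  linarith

end IsClassPH0

theorem hasDerivAt_radiusFun (α : ℝ) {r : ℝ} (h0 : 0 ≤ r) (h1 : r < 1) :
    HasDerivAt (radiusFun α)
      (2 * r + 1 + 2 * (1 - α) * (r / (1 - r))
        + 4 * (1 - α) ^ 2 * (2 * r ^ 3 / (1 - r ^ 2))) r := by
  have e1 : 1 - r ≠ 0 := by linarith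
  have e2 : 1 - r ^ 2 ≠ 0 := by nlinarith
  have d1 : HasDerivAt (fun r : ℝ => 1 - r) (-1) r := (hasDerivAt_id r).const_sub 1
  have d2 : HasDerivAt (fun r : ℝ => r ^ 2) (2 * r) r := by simpa using hasDerivAt_pow 2 r
  have d3 : HasDerivAt (fun r : ℝ => 1 - r ^ 2) (-(2 * r)) r := d2.const_sub 1
  have d := (((d2.add (hasDerivAt_id r)).sub_const 1).sub
    (((hasDerivAt_id r).add (d1.log e1)).const_mul (2 * (1 - α)))).sub
    ((d2.add (d3.log e2)).const_mul (4 * (1 - α) ^ 2)) |>.sub_const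
    (2 * (1 - α) * (Real.log 2 - 1))
  refine d.congr_deriv ?_
  field_simp
  ring

theorem continuousOn_radiusFun (α : ℝ) : ContinuousOn (radiusFun α) (Ico 0 1) := fun _ hr =>
  (hasDerivAt_radiusFun α hr.1 hr.2).continuousAt.continuousWithinAt

theorem strictMonoOn_radiusFun {α : ℝ} (hα : α < 1) : StrictMonoOn (radiusFun α) (Ico 0 1) := by
  refine strictMonoOn_of_deriv_pos (convex_Ico 0 1) (continuousOn_radiusFun α) fun r hr => ?_
  rw [interior_Ico] at hr
  obtain ⟨h0, h1⟩ := hr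
  rw [(hasDerivAt_radiusFun α h0.le h1).deriv]
  have e1 : 0 < 1 - r := by linarith
  have e2 : 0 < 1 - r ^ 2 := by nlinarith
  have e3 : 0 < 1 - α := by linarith
  positivity

theorem radiusFun_zero_neg {α : ℝ} (hα0 : 0 ≤ α) (hα1 : α < 1) : radiusFun α 0 < 0 := by
  have := Real.log_two_gt_d9
  simp [radiusFun]
  nlinarith

theorem exists_radiusFun_pos {α : ℝ} (hα0 : 0 ≤ α) (hα : α < 1) :
    ∃ r ∈ Ioo (0 : ℝ) 1, 0 < radiusFun α r := by
  have hα' : 0 < 1 - α := by linarith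
  -- at `r = 1 - exp (-M)` the term `-2 (1 - α) log (1 - r)` equals `2 (1 - α) M = 8`
  set M := 4 / (1 - α) with hM
  have hM0 : 0 < M := by positivity
  have hMα : (1 - α) * M = 4 := by rw [hM]; field_simp
  set r := 1 - Real.exp (-M) with hr
  have hr1 : r < 1 := by linarith [Real.exp_pos (-M)]
  have hr0 : 0 < r := by
    have : Real.exp (-M) < 1 := by
      rw [← Real.exp_zero]
      exact Real.exp_lt_exp.2 (by linarith)
    linarith
  refine ⟨r, ⟨hr0, hr1⟩, ?_⟩
  have hlog1 : Real.log (1 - r) = -M := by rw [hr, sub_sub_cancel, Real.log_exp]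
  have hlog2 : Real.log (1 - r ^ 2) ≤ (1 - r ^ 2) - 1 :=
    Real.log_le_sub_one_of_pos (by nlinarith)
  have h2 : 0 ≤ 4 * (1 - α) ^ 2 * (-(r ^ 2 + Real.log (1 - r ^ 2))) :=
    mul_nonneg (by positivity) (by linarith)
  have h3 : Real.log 2 < 1 := by linarith [Real.log_two_lt_d9]
  have h4 : (1 - α) * r ≤ (1 - α) * 1 := by gcongr
  have h5 : (1 - α) * Real.log 2 < (1 - α) * 1 := by gcongr
  rw [radiusFun, hlog1]
  nlinarith

/-! ### The extremal map -/

/-- The analytic map `z + ∑ 2 (1 - α) zⁿ / n` (sum over `n ≥ 2`), in closed form. -/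
noncomputable def extremalMap (α : ℝ) (z : ℂ) : ℂ :=
  (2 * α - 1) * z - 2 * (1 - α) * Complex.log (1 - z)

theorem one_sub_mem_slitPlane {z : ℂ} (hz : z ∈ unitDisk) : 1 - z ∈ Complex.slitPlane := by
  refine Or.inl ?_
  have h1 := (Complex.re_le_norm z).trans_lt (norm_lt_one_of_mem hz)
  simpa using h1

theorem hasDerivAt_extremalMap (α : ℝ) {z : ℂ} (hz : z ∈ unitDisk) :
    HasDerivAt (extremalMap α) ((2 * α - 1) + 2 * (1 - α) * (1 - z)⁻¹) z := by
  have h1 : HasDerivAt (fun z : ℂ => 1 - z) (-1) z := (hasDerivAt_id z).const_sub 1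
  have h2 := ((hasDerivAt_id z).const_mul (2 * (α : ℂ) - 1)).sub
    ((h1.clog (one_sub_mem_slitPlane hz)).const_mul (2 * (1 - (α : ℂ))))
  refine h2.congr_deriv ?_
  rw [div_eq_mul_inv]
  ring

theorem half_lt_re_inv_one_sub {z : ℂ} (hz : z ∈ unitDisk) : 1 / 2 < ((1 - z)⁻¹).re := by
  have h1 := norm_lt_one_of_mem hz
  have h2 : z.re * z.re + z.im * z.im < 1 := by
    rw [← Complex.normSq_apply, Complex.normSq_eq_norm_sq]
    nlinarith [norm_nonneg z]
  have h3 : 0 < Complex.normSq (1 - z) :=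
    Complex.normSq_pos.2 (Complex.slitPlane_ne_zero (one_sub_mem_slitPlane hz))
  rw [Complex.inv_re, div_lt_div_iff₀ two_pos h3, Complex.normSq_apply]
  simp
  nlinarith

theorem isClassPH0_extremalMap {α : ℝ} (hα : α < 1) : IsClassPH0 α (extremalMap α) 0 where
  analytic_h := fun _ hz => (hasDerivAt_extremalMap α hz).differentiableAt.differentiableWithinAt
  analytic_g := differentiableOn_const 0
  h_zero := by simp [extremalMap]
  deriv_h_zero := by
    rw [(hasDerivAt_extremalMap α (mem_unitDisk (by simp))).deriv]
    simp
    ring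
  g_zero := rfl
  deriv_g_zero := by simp
  re_gt := fun z hz => by
    have h1 := half_lt_re_inv_one_sub hz
    have h2 : (2 * (α : ℂ) - 1) + 2 * (1 - α) * (1 - z)⁻¹ - α
        = ((α - 1 : ℝ) : ℂ) + ((2 * (1 - α) : ℝ) : ℂ) * (1 - z)⁻¹ := by
      push_cast
      ring
    rw [(hasDerivAt_extremalMap α hz).deriv, h2, Complex.add_re, Complex.re_ofReal_mul,
      Complex.ofReal_re]
    simp only [deriv_zero, Pi.zero_apply, norm_zero]
    nlinarith

theorem taylorCoeff_zero_fun (n : ℕ) : taylorCoeff 0 n = 0 :=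
  taylorCoeff_eq_of_hasSum (c := fun _ => 0) (fun z _ => by simp [hasSum_zero]) n

theorem taylorCoeff_extremalMap (α : ℝ) {n : ℕ} (hn : 2 ≤ n) :
    taylorCoeff (extremalMap α) n = ((2 * (1 - α) / n : ℝ) : ℂ) := by
  have key := taylorCoeff_eq_of_hasSum (f := extremalMap α)
    (c := fun n : ℕ => (if n = 1 then (2 * α - 1 : ℂ) else 0) + 2 * (1 - α) / n) (fun z hz => ?_) n
  · rw [key, if_neg (by omega)]
    push_cast
    ring
  · have h1 := (Complex.hasSum_taylorSeries_neg_log (norm_lt_one_of_mem hz)).mul_left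
      (2 * (1 - (α : ℂ)))
    have h2 := (hasSum_ite_eq 1 ((2 * α - 1 : ℂ) * z)).add h1
    have e : extremalMap α z
        = (2 * α - 1 : ℂ) * z + 2 * (1 - (α : ℂ)) * -Complex.log (1 - z) := by
      rw [extremalMap]; ring
    rw [e]
    refine h2.congr_fun fun n => ?_
    split_ifs with hn
    · rw [hn]; ring
    · ring

theorem norm_taylorCoeff_deriv_extremalMap {α : ℝ} (hα : α < 1) (n : ℕ) :
    ‖taylorCoeff (deriv (extremalMap α)) n‖ = if n = 0 then 1 else 2 * (1 - α) := by
  split_ifs with hn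
  · rw [hn, taylorCoeff_zero, (isClassPH0_extremalMap hα).deriv_h_zero, norm_one]
  · rw [taylorCoeff_deriv, taylorCoeff_extremalMap α (by omega)]
    have h1 : ((n : ℂ) + 1) * ((2 * (1 - α) / ((n + 1 : ℕ) : ℝ) : ℝ) : ℂ)
        = ((2 * (1 - α) : ℝ) : ℂ) := by
      have : (n : ℂ) + 1 ≠ 0 := by exact_mod_cast n.succ_ne_zero
      push_cast
      field_simp
    rw [h1, Complex.norm_real, Real.norm_of_nonneg (by linarith)]

theorem bohrAreaSum_extremalMap {α : ℝ} (hα0 : 0 ≤ α) (hα1 : α < 1) {r : ℝ} (h0 : 0 ≤ r)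
    (h1 : r < 1) :
    bohrAreaSum (extremalMap α) 0 r = radiusFun α r + growthBound α 1 := by
  have H := isClassPH0_extremalMap hα1
  have hsum : ∑' n : ℕ, majorantTerm (extremalMap α) 0 r (n + 2)
      = -(2 * (1 - α) * (r + Real.log (1 - r))) := by
    rw [← (hasSum_majorant_bound α h0 h1).tsum_eq]
    congr 1
    funext n
    have h2 : 0 ≤ 2 * (1 - α) / ((n + 2 : ℕ) : ℝ) := div_nonneg (by linarith) (by positivity)
    rw [majorantTerm, taylorCoeff_extremalMap α (by omega), taylorCoeff_zero_fun, norm_zero,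
      add_zero, Complex.norm_real, Real.norm_of_nonneg h2]
  have harea : imageArea (harmonicMap (extremalMap α) 0) r / Real.pi
      = r ^ 2 - 4 * (1 - α) ^ 2 * (r ^ 2 + Real.log (1 - r ^ 2)) := by
    rw [← toReal_ofReal_area_div_pi α h0 h1, ← tsum_area_bound α h0 h1, imageArea,
      volume_image_ball_eq H.analytic_h h1 ((H.injOn hα0).mono (ball_subset_ball h1.le)),
      setLIntegral_ball_sq_norm (differentiableOn_deriv H.analytic_h) h0 h1]
    simp only [norm_taylorCoeff_deriv_extremalMap hα1]
  rw [bohrAreaSum, hsum, harea, radiusFun, growthBound_one]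
  ring

/-- Along the negative radius the extremal map attains the growth bound in the limit. -/
theorem boundaryDist_extremalMap_le {α : ℝ} (hα0 : 0 ≤ α) (hα1 : α < 1) :
    boundaryDist (harmonicMap (extremalMap α) 0) ≤ growthBound α 1 := by
  have H := isClassPH0_extremalMap hα1
  obtain ⟨ρ, hρ0, hρ1, hlim⟩ := exists_seq_tendsto_one
  have hnorm : ∀ n, ‖-(ρ n : ℂ)‖ = ρ n := fun n => by
    rw [norm_neg, Complex.norm_real, Real.norm_of_nonneg (hρ0 n)]
  have hval : ∀ n,
      harmonicMap (extremalMap α) 0 (-(ρ n : ℂ)) = ((-growthBound α (ρ n) : ℝ) : ℂ) := by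
    intro n
    have h2 : Complex.log (1 - -(ρ n : ℂ)) = (Real.log (1 + ρ n) : ℂ) := by
      rw [Complex.ofReal_log (by linarith [hρ0 n])]
      push_cast
      rw [sub_neg_eq_add]
    simp only [harmonicMap, extremalMap, growthBound, h2, Pi.zero_apply, map_zero, add_zero]
    push_cast
    ring
  have hmem : ((-growthBound α 1 : ℝ) : ℂ) ∈
      frontier (harmonicMap (extremalMap α) 0 '' unitDisk) := by
    refine H.mem_frontier_of_tendsto hα0 (u := fun n => -(ρ n : ℂ))
      (fun n => mem_unitDisk (by rw [hnorm]; exact hρ1 n)) (by simpa only [hnorm] using hlim) ?_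
    simp only [hval]
    refine (Complex.continuous_ofReal.tendsto _).comp (Filter.Tendsto.neg ?_)
    exact (hasDerivAt_growthBound α zero_le_one).continuousAt.tendsto.comp hlim
  have hpos : 0 ≤ growthBound α 1 := by
    rw [growthBound_one]
    nlinarith [Real.log_two_gt_d9]
  refine (infDist_le_dist_of_mem hmem).trans_eq ?_
  rw [H.harmonicMap_zero, dist_zero_left, Complex.norm_real, norm_neg, Real.norm_of_nonneg hpos]

theorem mainTheorem11 (α : ℝ) (hα0 : 0 ≤ α) (hα1 : α < 1) :
    ∃ rα : ℝ,
      IsLeast {r : ℝ | r ∈ Set.Ioo (0 : ℝ) 1 ∧ radiusFun α r = 0} rα ∧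
      (∀ h g : ℂ → ℂ, IsClassPH0 α h g → ∀ r : ℝ, 0 ≤ r → r ≤ rα →
        Summable (fun n : ℕ => majorantTerm h g r (n + 2)) ∧
        bohrAreaSum h g r ≤ boundaryDist (harmonicMap h g)) ∧
      (∀ r : ℝ, rα < r → r < 1 →
        ∃ h g : ℂ → ℂ, IsClassPH0 α h g ∧
          Summable (fun n : ℕ => majorantTerm h g r (n + 2)) ∧
          boundaryDist (harmonicMap h g) < bohrAreaSum h g r) := by
  have hmono := strictMonoOn_radiusFun hα1
  obtain ⟨s, hs, hpos⟩ := exists_radiusFun_pos hα0 hα1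
  obtain ⟨ρ, hρ, hzero⟩ := intermediate_value_Ioo hs.1.le
    ((continuousOn_radiusFun α).mono (Icc_subset_Ico_right hs.2))
    (show (0 : ℝ) ∈ Ioo (radiusFun α 0) (radiusFun α s) from ⟨radiusFun_zero_neg hα0 hα1, hpos⟩)
  have hρ1 : ρ < 1 := hρ.2.trans hs.2
  refine ⟨ρ, ⟨⟨⟨hρ.1, hρ1⟩, hzero⟩, fun r hr => ?_⟩, fun h g H r h0 hr => ?_, fun r hr h1 => ?_⟩
  · refine (hmono.le_iff_le ⟨hρ.1.le, hρ1⟩ ⟨hr.1.1.le, hr.1.2⟩).1 ?_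
    rw [hr.2, hzero]
  · have h1 : r < 1 := hr.trans_lt hρ1
    refine ⟨H.summable_majorantTerm h0 h1, ?_⟩
    have h2 := (hmono.le_iff_le ⟨h0, h1⟩ ⟨hρ.1.le, hρ1⟩).2 hr
    linarith [H.bohrAreaSum_le hα0 h0 h1, H.growthBound_one_le_boundaryDist hα0 hα1]
  · have h0 : 0 ≤ r := hρ.1.le.trans hr.le
    have H := isClassPH0_extremalMap hα1
    refine ⟨extremalMap α, 0, H, H.summable_majorantTerm h0 h1, ?_⟩
    have h2 := hmono ⟨hρ.1.le, hρ1⟩ ⟨h0, h1⟩ hr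
    rw [bohrAreaSum_extremalMap hα0 hα1 h0 h1]
    linarith [boundaryDist_extremalMap_le hα0 hα1]
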